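/- \textbf{Setting.} Let $A$ be an alphabet with a symmetric irreflexive commutation relation $\theta$; let $\mathbb M(A,\theta)$ be the trace monoid ($ab=ba$ for $(a,b)\in\theta$), and let $f$ be the foliage morphism from the free magma of binary trees with leaves in $A$ to $\mathbb M(A,\theta)$, $f(a)=a$ for $a\in A$. For traces put $(w,w')\in\theta_{\mathbb M}$ iff $ww'=w'w$ and no letter occurs in both $w$ and $w'$. A \emph{transitive Hall set} is a set $H$ of trees with a total order $<$ such that: (1) $(f(h))_{h\in H}$ is, for the reverse order, a complete factorization of $\mathbb M(A,\theta)$, i.e. the ordered product is a bijection from the restricted product of the submonoids $\langle f(h)\rangle$, with indices in decreasing order, onto $\mathbb M(A,\theta)$; (2) $A\subset H$; (3) if $h=(h',h'')\in H$ then $h''\in H$ and $h<h''$; (4) a tree $(h',h'')$ is in $H$ iff $h',h''\in H$, $h'<h''$, $(f(h'),f(h''))\notin\theta_{\mathbb M}$, and either $h'\in A$ or $h'=(x,y)$ with $y\ge h''$. A \emph{standard sequence} is a finite sequence $(h_1,\dots,h_n)$ in $H$ such that, for each $i$, either $h_i\in A$, or $h_i=(h_i',h_i'')$ with $h_i''\ge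 h_{i+1},\dots,h_n$. \emph{Decreasing} means $h_1\ge\dots\ge h_n$. A \emph{legal ascent} of $s=(h_1,\dots,h_n)$ is an index $i$ with $h_i<h_{i+1}$ and $h_{i+1}\ge h_{i+2},\dots,h_n$. Put $\lambda_i(s)=(h_1,\dots,h_{i-1},(h_i,h_{i+1}),h_{i+2},\dots,h_n)$ and $\rho_i(s)=(h_1,\dots,h_{i-1},h_{i+1},h_i,h_{i+2},\dots,h_n)$. For a legal ascent $i$ of $s$ write $s\to\rho_i(s)$ if $(f(h_i),f(h_{i+1}))\in\theta_{\mathbb M}$ and $s\to\lambda_i(s)$ otherwise; $\to^*$ is the reflexive transitive closure of $\to$. The \emph{derivation tree} $T(s)$ is the single node $s$ if $s$ is decreasing; otherwise, with $i$ the greatest legal ascent of $s$, it has root $s$ and the only sub-tree $T(\rho_i(s))$ if $(f(h_i),f(h_{i+1}))\in\theta_{\mathbb M}$, and root $s$, left sub-tree $T(\lambda_i(s))$ and right sub-tree $T(\rho_i(s))$ if not. Let $K$ be a commutative ring and $K\langle A,\theta\rangle$ the monoid algebra of $\mathbb M(A,\theta)$. Put $[a]=a$ for $a\in A$, $[(x,y)]=[x][y]-[y][x]$,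 and $[s]=[h_1]\cdots[h_n]$ for a sequence $s=(h_1,\dots,h_n)$. \textbf{Theorem.} Let $H$ be a transitive Hall set for $(A,\theta)$ and $K$ a commutative ring. \begin{enumerate} \item If $s$ is standard and $s\to s'$, then $s'$ is standard. There is no infinite chain of rewriting steps from a standard sequence, and no step applies to a standard sequence if and only if it is decreasing. \item For every standard sequence $s$ there is a unique decreasing standard sequence $s'$ with $s\to^* s'$. \item Every standard sequence $s$ has a (finite) derivation tree $T(s)$, it is unique, its leaves are labelled by decreasing standard sequences, and $[s]=\sum_{s'}[s']$ in $K\langle A,\theta\rangle$, the sum being over the leaves of $T(s)$ counted with multiplicity. \item Every word $w=a_1\cdots a_n$, seen as the sequence $(a_1,\dots,a_n)$ of letters, is a standard sequence, and the decreasing standard sequence $(h_1,\dots,h_k)$ with $(a_1,\dots,a_n)\to^*(h_1,\dots,h_k)$ satisfies $f(h_1)\cdots f(h_k)=a_1\cdots a_n$ in $\mathbb M(A,\theta)$; it is the only decreasing sequence in $H$ with this property. \item The products $[s]$, for $s$ a decreasing standard sequence, form a basis of the $K$-module $K\langle A,\theta\rangle$ (the PBW basis associated with $H$). If $P=\sum_m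 P_m\, m\in K\langle A,\theta\rangle$ and $w_m$ is any word representing the trace $m$, then the coordinate of $P$ on $[s]$ is $\sum_m P_m\cdot\#\{\text{leaves of }T(w_m)\text{ labelled }s\}$. \end{enumerate} -/

import Mathlib

namespace THS

universe u v

/-! ## Trace monoids, trees and foliages

A commutation alphabet `(A, θ)` is a type `A` with a symmetric irreflexive relation on it, that is,
a simple graph `θ`, whose edges are the pairs of commuting letters. -/

/-- The elementary commutations `ab ~ ba` for `(a, b) ∈ θ`. -/
inductive CommRel {A : Type u} (θ : SimpleGraph A) : FreeMonoid A → FreeMonoid A → Prop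
  | swap (a b : A) (hab : θ.Adj a b) :
      CommRel θ (FreeMonoid.of a * FreeMonoid.of b) (FreeMonoid.of b * FreeMonoid.of a)

/-- The trace monoid (free partially commutative monoid) `𝕄(A, θ)`. -/
abbrev TraceMonoid {A : Type u} (θ : SimpleGraph A) : Type u :=
  PresentedMonoid (CommRel θ)

/-- The trace of a letter. -/
def letter {A : Type u} (θ : SimpleGraph A) (a : A) : TraceMonoid θ :=
  PresentedMonoid.of (CommRel θ) a

/-- The trace represented by a word. -/
def traceOf {A : Type u} (θ : SimpleGraph A) (w : List A) : TraceMonoid θ :=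
  (w.map (letter θ)).prod

/-- The set of letters occurring in a trace. -/
def alph {A : Type u} {θ : SimpleGraph A} (t : TraceMonoid θ) : Set A :=
  {a | ∃ p q : TraceMonoid θ, t = p * letter θ a * q}

/-- The relation `θ_𝕄` on traces: commuting with disjoint alphabets. -/
def DisjComm {A : Type u} {θ : SimpleGraph A} (t t' : TraceMonoid θ) : Prop :=
  t * t' = t' * t ∧ Disjoint (alph t) (alph t')

/-- The foliage morphism, from binary trees with leaves in `A` (the free magma) to traces. -/
def foliage {A : Type u} (θ : SimpleGraph A) : FreeMagma A →ₙ* TraceMonoid θ :=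
  FreeMagma.lift (letter θ)

/-! ## Factorizations of monoids -/

/-- The restricted product of a family of submonoids: families with finite support. -/
abbrev RestrictedProd {ι : Type u} {M : Type v} [Monoid M] (N : ι → Submonoid M) : Type (max u v) :=
  {g : (i : ι) → N i // {i | g i ≠ 1}.Finite}

/-- The ordered product of a family with finite support. -/
noncomputable def orderedProd {ι : Type u} [LinearOrder ι] {M : Type v} [Monoid M]
    {N : ι → Submonoid M} (g : RestrictedProd N) : M :=
  ((g.2.toFinset.sort (· ≤ ·)).map fun i => (g.1 i : M)).prod

/-- A family of submonoids indexed by a totally ordered set is a factorization if the ordered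
product is a bijection from the restricted product onto the monoid. -/
def IsFactorization {ι : Type u} [LinearOrder ι] {M : Type v} [Monoid M]
    (N : ι → Submonoid M) : Prop :=
  Function.Bijective (orderedProd (N := N))

/-! ## Transitive Hall sets -/

/-- The order of `H`, as a relation between trees (it only relates elements of `H`). -/
def treeLT {A : Type u} (H : Set (FreeMagma A)) [LinearOrder H] (x y : FreeMagma A) : Prop :=
  ∃ (hx : x ∈ H) (hy : y ∈ H), (⟨x, hx⟩ : H) < ⟨y, hy⟩

/-- The weak order of `H`, as a relation between trees (it only relates elements of `H`). -/
def treeLE {A : Type u} (H : Set (FreeMagma A)) [LinearOrder H] (x y : FreeMagma A) : Prop :=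
  ∃ (hx : x ∈ H) (hy : y ∈ H), (⟨x, hx⟩ : H) ≤ ⟨y, hy⟩

/-- A totally ordered set `H` of trees is a transitive Hall set for `(A, θ)`. -/
structure IsTransitiveHallSet {A : Type u} (θ : SimpleGraph A) (H : Set (FreeMagma A))
    [LinearOrder H] : Prop where
  /-- The foliages of the elements of `H`, for the reverse order, are a complete factorization. -/
  factorization : IsFactorization (ι := Hᵒᵈ)
    (fun h : Hᵒᵈ => Submonoid.closure {foliage θ (OrderDual.ofDual h).1})
  letter_mem : ∀ a : A, FreeMagma.of a ∈ H
  lt_right : ∀ x y : FreeMagma A, x * y ∈ H → y ∈ H ∧ treeLT H (x * y) y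
  mul_mem_iff : ∀ x y : FreeMagma A, x * y ∈ H ↔
    x ∈ H ∧ y ∈ H ∧ treeLT H x y ∧ ¬ DisjComm (foliage θ x) (foliage θ y) ∧
      ((∃ a : A, x = FreeMagma.of a) ∨ ∃ p q : FreeMagma A, x = p * q ∧ treeLE H y q)

/-! ## Standard sequences and their rewriting (positions are counted from `0`) -/

/-- `s = (h₀, …, hₙ₋₁)` is a standard sequence of elements of `H`: each `hᵢ` is a letter, or
`hᵢ = (h', h'')` with `h'' ≥ hⱼ` for all `j > i`. -/
def IsStandard {A : Type u} (H : Set (FreeMagma A)) [LinearOrder H] (s : List (FreeMagma A)) :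
    Prop :=
  (∀ h ∈ s, h ∈ H) ∧
    ∀ (l r : List (FreeMagma A)) (h : FreeMagma A), s = l ++ h :: r →
      (∃ a : A, h = FreeMagma.of a) ∨ ∃ x y : FreeMagma A, h = x * y ∧ ∀ k ∈ r, treeLE H k y

/-- `s` is a (weakly) decreasing sequence of elements of `H`. -/
def IsDecreasing {A : Type u} (H : Set (FreeMagma A)) [LinearOrder H] (s : List (FreeMagma A)) :
    Prop :=
  (∀ h ∈ s, h ∈ H) ∧ s.Pairwise fun h k => treeLE H k h

/-- The position `i` is a legal ascent of `s`: `hᵢ < hᵢ₊₁` and `hᵢ₊₁ ≥ hⱼ` for all `j ≥ i + 2`. -/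
def IsLegalAscent {A : Type u} (H : Set (FreeMagma A)) [LinearOrder H] (s : List (FreeMagma A))
    (i : ℕ) : Prop :=
  ∃ x y : FreeMagma A, s[i]? = some x ∧ s[i + 1]? = some y ∧ treeLT H x y ∧
    ∀ z ∈ s.drop (i + 2), treeLE H z y

/-- The foliages of `hᵢ` and `hᵢ₊₁` are related by `θ_𝕄`. -/
def CommutesAt {A : Type u} (θ : SimpleGraph A) (s : List (FreeMagma A)) (i : ℕ) : Prop :=
  ∃ x y : FreeMagma A, s[i]? = some x ∧ s[i + 1]? = some y ∧
    DisjComm (foliage θ x) (foliage θ y)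

/-- `λᵢ(s)`: replace the two consecutive terms `hᵢ, hᵢ₊₁` by the single term `(hᵢ, hᵢ₊₁)`. -/
def lam {A : Type u} : List (FreeMagma A) → ℕ → List (FreeMagma A)
  | x :: y :: s, 0 => (x * y) :: s
  | x :: s, i + 1 => x :: lam s i
  | s, _ => s

/-- `ρᵢ(s)`: exchange the two consecutive terms `hᵢ, hᵢ₊₁`. -/
def rho {A : Type u} : List (FreeMagma A) → ℕ → List (FreeMagma A)
  | x :: y :: s, 0 => y :: x :: s
  | x :: s, i + 1 => x :: rho s i
  | s, _ => s

/-- One rewriting step `s → s'`, at some legal ascent of `s`. -/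
inductive Step {A : Type u} (θ : SimpleGraph A) (H : Set (FreeMagma A)) [LinearOrder H] :
    List (FreeMagma A) → List (FreeMagma A) → Prop
  | bracket (s : List (FreeMagma A)) (i : ℕ) (hi : IsLegalAscent H s i)
      (hc : ¬ CommutesAt θ s i) : Step θ H s (lam s i)
  | swap (s : List (FreeMagma A)) (i : ℕ) (hi : IsLegalAscent H s i)
      (hc : CommutesAt θ s i) : Step θ H s (rho s i)

/-- `s →* s'`: the reflexive transitive closure of `→`. -/
def Steps {A : Type u} (θ : SimpleGraph A) (H : Set (FreeMagma A)) [LinearOrder H] :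
    List (FreeMagma A) → List (FreeMagma A) → Prop :=
  Relation.ReflTransGen (Step θ H)

/-- The sequence of one-letter trees of a word. -/
def letterSeq {A : Type u} (w : List A) : List (FreeMagma A) := w.map FreeMagma.of

/-! ## Derivation trees -/

/-- Trees whose nodes are labelled by sequences and have zero, one or two sub-trees. -/
inductive DTree (A : Type u) : Type u
  | leaf (s : List (FreeMagma A)) : DTree A
  | unary (s : List (FreeMagma A)) (t : DTree A) : DTree A
  | binary (s : List (FreeMagma A)) (l r : DTree A) : DTree A

/-- The list of the labels of the leaves, from left to right and with repetitions. -/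
def DTree.leaves {A : Type u} : DTree A → List (List (FreeMagma A))
  | .leaf s => [s]
  | .unary _ t => t.leaves
  | .binary _ l r => l.leaves ++ r.leaves

open Classical in
/-- The number of leaves with label `s`. -/
noncomputable def DTree.mult {A : Type u} (T : DTree A) (s : List (FreeMagma A)) : ℕ :=
  T.leaves.count s

/-- `T` is the derivation tree of the sequence `s`. -/
inductive IsDerivationTree {A : Type u} (θ : SimpleGraph A) (H : Set (FreeMagma A))
    [LinearOrder H] : List (FreeMagma A) → DTree A → Prop
  | leaf (s : List (FreeMagma A)) (hs : IsDecreasing H s) : IsDerivationTree θ H s (.leaf s)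
  | unary (s : List (FreeMagma A)) (i : ℕ) (t : DTree A) (hs : ¬ IsDecreasing H s)
      (hi : IsGreatest {j | IsLegalAscent H s j} i) (hc : CommutesAt θ s i)
      (ht : IsDerivationTree θ H (rho s i) t) : IsDerivationTree θ H s (.unary s t)
  | binary (s : List (FreeMagma A)) (i : ℕ) (l r : DTree A) (hs : ¬ IsDecreasing H s)
      (hi : IsGreatest {j | IsLegalAscent H s j} i) (hc : ¬ CommutesAt θ s i)
      (hl : IsDerivationTree θ H (lam s i) l) (hr : IsDerivationTree θ H (rho s i) r) :
      IsDerivationTree θ H s (.binary s l r)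

/-! ## Partially commutative polynomials -/

/-- The algebra `K⟨A, θ⟩` of partially commutative polynomials. -/
abbrev Poly (K : Type v) [CommRing K] {A : Type u} (θ : SimpleGraph A) : Type (max v u) :=
  MonoidAlgebra K (TraceMonoid θ)

/-- The Lie polynomial `[h]` of a tree: `[a] = a` for a letter, `[(x, y)] = [x][y] - [y][x]`. -/
noncomputable def lieEval (K : Type v) [CommRing K] {A : Type u} (θ : SimpleGraph A) :
    FreeMagma A → Poly K θ
  | .of a => MonoidAlgebra.of K (TraceMonoid θ) (letter θ a)
  | .mul x y => ⁅lieEval K θ x, lieEval K θ y⁆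

/-- `[s] = [h₀] ⋯ [hₙ₋₁]`. -/
noncomputable def seqEval (K : Type v) [CommRing K] {A : Type u} (θ : SimpleGraph A)
    (s : List (FreeMagma A)) : Poly K θ :=
  (s.map (lieEval K θ)).prod

end THS

/-! Three invariants carry the proof. A legal ascent of a standard sequence may be bracketed (if the
foliages are not related by `DisjComm`) or exchanged, and the result is again standard
(`IsStandard.lam`, `IsStandard.rho`). The length followed by the number of ascents decreases
lexicographically, so rewriting and derivation trees terminate (`wellFounded_move`).

Rewriting preserves the product of the foliages, and a decreasing sequence is determined by this
product because `H` gives a factorization (`IsDecreasing.eq_of_prod_eq`). Normal forms are therefore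
unique without any confluence argument.

On the Lie side, `xy = [x, y] + yx`, or `xy = yx` when the foliages are related by `DisjComm`, turns
a derivation tree into an expansion of `[s]`. Hence the decreasing products span, and they do so
inside each multidegree. They are in bijection with the traces, and each multidegree contains
finitely many traces. A surjective endomorphism of a finite module over a commutative ring is
injective, so they are independent; no triangularity is needed. -/

namespace THS

universe u v

variable {A : Type u} {θ : SimpleGraph A} {H : Set (FreeMagma A)} [LinearOrder H]

/-! ## The order on trees -/

lemma treeLT.treeLE {x y : FreeMagma A} (h : treeLT H x y) : treeLE H x y :=
  let ⟨hx, hy, h⟩ := h; ⟨hx, hy, h.le⟩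

lemma treeLE.trans {x y z : FreeMagma A} (h : treeLE H x y) (h' : treeLE H y z) :
    treeLE H x z :=
  let ⟨hx, _, h⟩ := h; let ⟨_, hz, h'⟩ := h'; ⟨hx, hz, h.trans h'⟩

lemma treeLE.not_lt {x y : FreeMagma A} (h : treeLE H x y) : ¬ treeLT H y x :=
  fun h' => let ⟨_, _, h⟩ := h; let ⟨_, _, h'⟩ := h'; h.not_gt h'

lemma treeLT_or_treeLE {x y : FreeMagma A} (hx : x ∈ H) (hy : y ∈ H) :
    treeLT H x y ∨ treeLE H y x :=
  (lt_or_ge (⟨x, hx⟩ : H) ⟨y, hy⟩).imp (fun h => ⟨hx, hy, h⟩) fun h => ⟨hy, hx, h⟩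

/-! ## Standard and decreasing sequences -/

/-- `h` may precede the terms of `r` in a standard sequence. -/
def Admits (H : Set (FreeMagma A)) [LinearOrder H] (h : FreeMagma A) (r : List (FreeMagma A)) :
    Prop :=
  (∃ a : A, h = FreeMagma.of a) ∨ ∃ x y : FreeMagma A, h = x * y ∧ ∀ k ∈ r, treeLE H k y

lemma Admits.imp {h : FreeMagma A} {r r' : List (FreeMagma A)} (hr : Admits H h r)
    (H' : ∀ y, (∀ k ∈ r, treeLE H k y) → ∀ k ∈ r', treeLE H k y) : Admits H h r' :=
  Or.imp id (fun ⟨x, y, e, hk⟩ => ⟨x, y, e, H' y hk⟩) hr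

lemma isStandard_nil : IsStandard H [] := ⟨by simp, by simp⟩

lemma isStandard_cons {h : FreeMagma A} {s : List (FreeMagma A)} :
    IsStandard H (h :: s) ↔ h ∈ H ∧ Admits H h s ∧ IsStandard H s := by
  constructor
  · rintro ⟨h1, h2⟩
    exact ⟨h1 h (by simp), h2 [] s h rfl, fun k hk => h1 k (by simp [hk]),
      fun l r k e => h2 (h :: l) r k (by simp [e])⟩
  · rintro ⟨h1, h2, h3, h4⟩
    refine ⟨by simpa [h1] using h3, fun l r k e => ?_⟩
    cases l with
    | nil => obtain ⟨rfl, rfl⟩ : h = k ∧ s = r := by simpa using e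
             exact h2
    | cons c l => exact h4 l r k (by simp at e; exact e.2)

lemma IsStandard.of_append {l r : List (FreeMagma A)} (hs : IsStandard H (l ++ r)) :
    IsStandard H r := by
  induction l with
  | nil => exact hs
  | cons c l ih => exact ih (isStandard_cons.1 hs).2.2

/-- A prefix sees its tail only through upper bounds, so the tail may be replaced by any standard
one that keeps these bounds. -/
lemma IsStandard.append_congr {l r r' : List (FreeMagma A)} (hs : IsStandard H (l ++ r))
    (hr : IsStandard H r') (H' : ∀ y, (∀ k ∈ r, treeLE H k y) → ∀ k ∈ r', treeLE H k y) :
    IsStandard H (l ++ r') := by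
  induction l with
  | nil => exact hr
  | cons c l ih =>
    obtain ⟨h1, h2, h3⟩ := isStandard_cons.1 hs
    refine isStandard_cons.2 ⟨h1, h2.imp fun y hy k hk => ?_, ih h3⟩
    rcases List.mem_append.1 hk with hk | hk
    · exact hy k (by simp [hk])
    · exact H' y (fun k hk => hy k (by simp [hk])) k hk

lemma isStandard_letterSeq (hH : IsTransitiveHallSet θ H) (w : List A) :
    IsStandard H (letterSeq w) := by
  induction w with
  | nil => exact isStandard_nil
  | cons a w ih => exact isStandard_cons.2 ⟨hH.letter_mem a, Or.inl ⟨a, rfl⟩, ih⟩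

/-! ## Legal ascents and rewriting steps -/

lemma isLegalAscent_iff {s : List (FreeMagma A)} {i : ℕ} :
    IsLegalAscent H s i ↔ ∃ l x y r, s = l ++ x :: y :: r ∧ l.length = i ∧ treeLT H x y ∧
      ∀ z ∈ r, treeLE H z y := by
  constructor
  · rintro ⟨x, y, hx, hy, hxy, hr⟩
    obtain ⟨hi, rfl⟩ := List.getElem?_eq_some_iff.1 hx
    obtain ⟨hi', rfl⟩ := List.getElem?_eq_some_iff.1 hy
    refine ⟨s.take i, _, _, s.drop (i + 2), ?_, by simp; omega, hxy, hr⟩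
    rw [List.cons_getElem_drop_succ, List.cons_getElem_drop_succ, List.take_append_drop]
  · rintro ⟨l, x, y, r, rfl, rfl, hxy, hr⟩
    exact ⟨x, y, by simp, by simp, hxy, by
      rwa [← List.drop_drop, List.drop_left]⟩

lemma commutesAt_append (l r : List (FreeMagma A)) (x y : FreeMagma A) :
    CommutesAt θ (l ++ x :: y :: r) l.length ↔ DisjComm (foliage θ x) (foliage θ y) := by
  simp [CommutesAt]

lemma lam_append (l r : List (FreeMagma A)) (x y : FreeMagma A) :
    lam (l ++ x :: y :: r) l.length = l ++ (x * y) :: r := by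
  induction l with
  | nil => rfl
  | cons c l ih =>
    obtain ⟨d, t, e⟩ : ∃ d t, l ++ x :: y :: r = d :: t := by cases l <;> simp
    simp only [List.cons_append, List.length_cons]
    rw [e] at ih ⊢
    simp [lam, ih]

lemma rho_append (l r : List (FreeMagma A)) (x y : FreeMagma A) :
    rho (l ++ x :: y :: r) l.length = l ++ y :: x :: r := by
  induction l with
  | nil => rfl
  | cons c l ih =>
    obtain ⟨d, t, e⟩ : ∃ d t, l ++ x :: y :: r = d :: t := by cases l <;> simp
    simp only [List.cons_append, List.length_cons]
    rw [e] at ih ⊢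
    simp [rho, ih]

/-- The one new constraint is that `x` now follows `y`; if `y = (p, q)`, then `x < y < q`. Neither
legality nor commutation matters, so this also serves the right branches of derivation trees. -/
lemma IsStandard.rho (hH : IsTransitiveHallSet θ H) {l r : List (FreeMagma A)} {x y : FreeMagma A}
    (hs : IsStandard H (l ++ x :: y :: r)) (hxy : treeLT H x y) :
    IsStandard H (l ++ y :: x :: r) := by
  obtain ⟨hx, hx', hyr⟩ := isStandard_cons.1 hs.of_append
  obtain ⟨hy, hy', hr⟩ := isStandard_cons.1 hyr
  refine hs.append_congr (isStandard_cons.2 ⟨hy, ?_, isStandard_cons.2 ⟨hx, ?_, hr⟩⟩) ?_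
  · rcases hy' with h | ⟨p, q, rfl, h⟩
    · exact Or.inl h
    · refine Or.inr ⟨p, q, rfl, fun k hk => ?_⟩
      rcases List.mem_cons.1 hk with rfl | hk
      · exact hxy.treeLE.trans (hH.lt_right p q hy).2.treeLE
      · exact h k hk
  · exact hx'.imp fun z hz k hk => hz k (by simp [hk])
  · exact fun z hz k hk => hz k (by simp at hk ⊢; tauto)

/-- Standardness at `x` is exactly the last condition for `(x, y)` to be in `H`, and legality of the
ascent is standardness at `(x, y)`. Bounds required by earlier terms survive because `(x, y) < y`.
-/
lemma IsStandard.lam (hH : IsTransitiveHallSet θ H) {l r : List (FreeMagma A)} {x y : FreeMagma A}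
    (hs : IsStandard H (l ++ x :: y :: r)) (hxy : treeLT H x y) (hr : ∀ z ∈ r, treeLE H z y)
    (hc : ¬ DisjComm (foliage θ x) (foliage θ y)) :
    IsStandard H (l ++ (x * y) :: r) := by
  obtain ⟨hx, hx', hyr⟩ := isStandard_cons.1 hs.of_append
  obtain ⟨hy, hy', hr'⟩ := isStandard_cons.1 hyr
  have hmem : x * y ∈ H := (hH.mul_mem_iff x y).2 ⟨hx, hy, hxy, hc,
    Or.imp id (fun ⟨p, q, e, h⟩ => ⟨p, q, e, h y (by simp)⟩) hx'⟩
  refine hs.append_congr (isStandard_cons.2 ⟨hmem, Or.inr ⟨x, y, rfl, hr⟩, hr'⟩) fun z hz k hk => ?_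
  rcases List.mem_cons.1 hk with rfl | hk
  · exact (hH.lt_right x y hmem).2.treeLE.trans (hz y (by simp))
  · exact hz k (by simp [hk])

lemma step_iff {s s' : List (FreeMagma A)} :
    Step θ H s s' ↔ ∃ l x y r, s = l ++ x :: y :: r ∧ treeLT H x y ∧ (∀ z ∈ r, treeLE H z y) ∧
      (¬ DisjComm (foliage θ x) (foliage θ y) ∧ s' = l ++ (x * y) :: r ∨
        DisjComm (foliage θ x) (foliage θ y) ∧ s' = l ++ y :: x :: r) := by
  constructor
  · rintro (⟨i, hi, hc⟩ | ⟨i, hi, hc⟩) <;>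
      obtain ⟨l, x, y, r, rfl, rfl, hxy, hr⟩ := isLegalAscent_iff.1 hi <;>
      rw [commutesAt_append] at hc
    · exact ⟨l, x, y, r, rfl, hxy, hr, Or.inl ⟨hc, lam_append ..⟩⟩
    · exact ⟨l, x, y, r, rfl, hxy, hr, Or.inr ⟨hc, rho_append ..⟩⟩
  · rintro ⟨l, x, y, r, rfl, hxy, hr, ⟨hc, rfl⟩ | ⟨hc, rfl⟩⟩
    · rw [← lam_append]
      exact .bracket _ _ (isLegalAscent_iff.2 ⟨l, x, y, r, rfl, rfl, hxy, hr⟩)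
        (by rwa [commutesAt_append])
    · rw [← rho_append l r x y]
      exact .swap _ _ (isLegalAscent_iff.2 ⟨l, x, y, r, rfl, rfl, hxy, hr⟩)
        (by rwa [commutesAt_append])

lemma IsStandard.step (hH : IsTransitiveHallSet θ H) {s s' : List (FreeMagma A)}
    (hs : IsStandard H s) (h : Step θ H s s') : IsStandard H s' := by
  obtain ⟨l, x, y, r, rfl, hxy, hr, ⟨hc, rfl⟩ | ⟨hc, rfl⟩⟩ := step_iff.1 h
  · exact hs.lam hH hxy hr hc
  · exact hs.rho hH hxy

/-! ## Existence of legal ascents -/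

lemma not_isDecreasing_of_isLegalAscent {s : List (FreeMagma A)} {i : ℕ}
    (hi : IsLegalAscent H s i) : ¬ IsDecreasing H s := by
  obtain ⟨l, x, y, r, rfl, -, hxy, -⟩ := isLegalAscent_iff.1 hi
  intro hs
  have := (List.pairwise_append.1 hs.2).2.1
  exact (List.rel_of_pairwise_cons this (by simp : y ∈ y :: r)).not_lt hxy

/-- In the shortest suffix that is not decreasing, the first term lies below the second, which
dominates everything after it. -/
lemma exists_isLegalAscent {s : List (FreeMagma A)} (hs : ∀ h ∈ s, h ∈ H)
    (hd : ¬ IsDecreasing H s) : ∃ i, IsLegalAscent H s i := by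
  induction s with
  | nil => exact absurd ⟨hs, List.Pairwise.nil⟩ hd
  | cons x s ih =>
    by_cases hd' : IsDecreasing H s
    · cases s with
      | nil => exact absurd ⟨hs, List.pairwise_singleton _ _⟩ hd
      | cons y r =>
        have hr := (List.pairwise_cons.1 hd'.2).1
        rcases treeLT_or_treeLE (hs x (by simp)) (hs y (by simp)) with h | h
        · exact ⟨0, isLegalAscent_iff.2 ⟨[], x, y, r, rfl, rfl, h, hr⟩⟩
        · refine absurd ⟨hs, List.pairwise_cons.2 ⟨fun k hk => ?_, hd'.2⟩⟩ hd
          rcases List.mem_cons.1 hk with rfl | hk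
          · exact h
          · exact (hr k hk).trans h
    · obtain ⟨i, hi⟩ := ih (fun h hh => hs h (by simp [hh])) hd'
      obtain ⟨l, x', y, r, rfl, rfl, hxy, hr⟩ := isLegalAscent_iff.1 hi
      exact ⟨_, isLegalAscent_iff.2 ⟨x :: l, x', y, r, rfl, rfl, hxy, hr⟩⟩

lemma exists_isGreatest_isLegalAscent {s : List (FreeMagma A)} (hs : ∀ h ∈ s, h ∈ H)
    (hd : ¬ IsDecreasing H s) : ∃ i, IsGreatest {j | IsLegalAscent H s j} i := by
  have hfin : {j | IsLegalAscent H s j}.Finite := by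
    refine (Set.finite_Iio s.length).subset fun j hj => ?_
    obtain ⟨l, x, y, r, rfl, rfl, -⟩ := isLegalAscent_iff.1 hj
    simp
  exact ⟨_, Nat.sSup_mem (exists_isLegalAscent hs hd) hfin.bddAbove,
    fun _ hj => le_csSup hfin.bddAbove hj⟩

lemma not_exists_step_iff {s : List (FreeMagma A)} (hs : ∀ h ∈ s, h ∈ H) :
    (¬ ∃ s', Step θ H s s') ↔ IsDecreasing H s := by
  constructor
  · intro h
    by_contra hd
    obtain ⟨i, hi⟩ := exists_isLegalAscent hs hd
    by_cases hc : CommutesAt θ s i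
    · exact h ⟨_, .swap s i hi hc⟩
    · exact h ⟨_, .bracket s i hi hc⟩
  · rintro hd ⟨s', h | h⟩ <;> exact not_isDecreasing_of_isLegalAscent ‹_› hd

/-! ## Termination -/

open Classical in
/-- The number of pairs of positions `i < j` with `hᵢ < hⱼ`. -/
noncomputable def ascents (H : Set (FreeMagma A)) [LinearOrder H] : List (FreeMagma A) → ℕ
  | [] => 0
  | x :: s => s.countP (fun y => treeLT H x y) + ascents H s

/-- One elementary move at an ascent: bracketing or exchange. -/
def Move (H : Set (FreeMagma A)) [LinearOrder H] (s' s : List (FreeMagma A)) : Prop :=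
  ∃ l x y r, s = l ++ x :: y :: r ∧ treeLT H x y ∧
    (s' = l ++ (x * y) :: r ∨ s' = l ++ y :: x :: r)

lemma ascents_swap_lt {x y : FreeMagma A} (hxy : treeLT H x y) (l r : List (FreeMagma A)) :
    ascents H (l ++ y :: x :: r) < ascents H (l ++ x :: y :: r) := by
  classical
  induction l with
  | nil =>
    have := hxy.treeLE.not_lt
    simp [ascents, hxy, this]
    omega
  | cons c l ih =>
    have hp : (l ++ y :: x :: r).Perm (l ++ x :: y :: r) :=
      (List.Perm.refl l).append (.swap ..)
    simp only [List.cons_append, ascents, hp.countP_eq]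
    omega

/-- Bracketing shortens the sequence, whatever it does to the ascents; an exchange keeps the length
and removes an ascent. `Move` is used instead of `Step` because right branches exchange terms that
do not commute. -/
lemma wellFounded_move : WellFounded (Move H) := by
  refine Subrelation.wf (r := InvImage (Prod.Lex (· < ·) (· < ·))
    fun s : List (FreeMagma A) => (s.length, ascents H s)) ?_
    (InvImage.wf _ (WellFounded.prod_lex wellFounded_lt wellFounded_lt))
  rintro s' s ⟨l, x, y, r, rfl, hxy, rfl | rfl⟩
  · exact Prod.Lex.left _ _ (by simp)
  · have := ascents_swap_lt hxy l r
    simp only [InvImage, Prod.lex_def]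
    exact Or.inr ⟨by simp, this⟩

lemma Step.move {s s' : List (FreeMagma A)} (h : Step θ H s s') : Move H s' s := by
  obtain ⟨l, x, y, r, rfl, hxy, -, ⟨-, rfl⟩ | ⟨-, rfl⟩⟩ := step_iff.1 h
  · exact ⟨l, x, y, r, rfl, hxy, Or.inl rfl⟩
  · exact ⟨l, x, y, r, rfl, hxy, Or.inr rfl⟩

lemma exists_steps_isDecreasing (hH : IsTransitiveHallSet θ H) (s : List (FreeMagma A))
    (hs : IsStandard H s) :
    ∃ s', IsStandard H s' ∧ IsDecreasing H s' ∧ Steps θ H s s' := by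
  induction s using (wellFounded_move (H := H)).induction with
  | h s ih =>
    by_cases hd : IsDecreasing H s
    · exact ⟨s, hs, hd, .refl⟩
    · obtain ⟨s₁, h₁⟩ : ∃ s', Step θ H s s' := by
        by_contra h
        exact hd ((not_exists_step_iff hs.1).1 h)
      obtain ⟨s', h, h', h''⟩ := ih s₁ h₁.move (hs.step hH h₁)
      exact ⟨s', h, h', .head h₁ h''⟩

/-! ## Derivation trees -/

lemma IsDerivationTree.eq {s : List (FreeMagma A)} {T T' : DTree A}
    (hT : IsDerivationTree θ H s T) (hT' : IsDerivationTree θ H s T') : T' = T := by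
  induction hT generalizing T' with
  | leaf s hs => cases hT' with
    | leaf => rfl
    | unary => exact absurd hs ‹_›
    | binary => exact absurd hs ‹_›
  | unary s i t hs hi hc ht ih => cases hT' with
    | leaf => exact absurd ‹_› hs
    | unary _ i' t' _ hi' hc' ht' => obtain rfl := hi.unique hi'; rw [ih ht']
    | binary _ i' l' r' _ hi' hc' => obtain rfl := hi.unique hi'; exact absurd hc hc'
  | binary s i l r hs hi hc hl hr ihl ihr => cases hT' with
    | leaf => exact absurd ‹_› hs
    | unary _ i' t' _ hi' hc' => obtain rfl := hi.unique hi'; exact absurd hc' hc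
    | binary _ i' l' r' _ hi' hc' hl' hr' =>
      obtain rfl := hi.unique hi'; rw [ihl hl', ihr hr']

lemma exists_isDerivationTree (hH : IsTransitiveHallSet θ H) (s : List (FreeMagma A))
    (hs : IsStandard H s) : ∃ T, IsDerivationTree θ H s T := by
  induction s using (wellFounded_move (H := H)).induction with
  | h s ih =>
    by_cases hd : IsDecreasing H s
    · exact ⟨_, .leaf s hd⟩
    obtain ⟨i, hi⟩ := exists_isGreatest_isLegalAscent hs.1 hd
    obtain ⟨l, x, y, r, rfl, rfl, hxy, hr⟩ := isLegalAscent_iff.1 hi.1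
    obtain ⟨T, hT⟩ := ih _ ⟨l, x, y, r, rfl, hxy, Or.inr rfl⟩ (hs.rho hH hxy)
    rw [← rho_append] at hT
    by_cases hc : CommutesAt θ (l ++ x :: y :: r) l.length
    · exact ⟨_, .unary _ _ T hd hi hc hT⟩
    · obtain ⟨T', hT'⟩ := ih _ ⟨l, x, y, r, rfl, hxy, Or.inl rfl⟩
        (hs.lam hH hxy hr (by rwa [commutesAt_append] at hc))
      rw [← lam_append] at hT'
      exact ⟨_, .binary _ _ T' T hd hi hc hT' hT⟩

/-- Induction along a derivation tree, with explicit moves. -/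
lemma IsDerivationTree.leaves_induction (hH : IsTransitiveHallSet θ H)
    {motive : List (FreeMagma A) → List (List (FreeMagma A)) → Prop}
    (dec : ∀ s, IsStandard H s → IsDecreasing H s → motive s [s])
    (swap : ∀ l x y r L, DisjComm (foliage θ x) (foliage θ y) → motive (l ++ y :: x :: r) L →
      motive (l ++ x :: y :: r) L)
    (bracket : ∀ l x y r L L', motive (l ++ (x * y) :: r) L → motive (l ++ y :: x :: r) L' →
      motive (l ++ x :: y :: r) (L ++ L'))
    {s : List (FreeMagma A)} {T : DTree A} (hT : IsDerivationTree θ H s T) (hs : IsStandard H s) :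
    motive s T.leaves := by
  induction hT with
  | leaf s hd => exact dec s hs hd
  | unary s i t hd hi hc ht ih =>
    obtain ⟨l, x, y, r, rfl, rfl, hxy, hr⟩ := isLegalAscent_iff.1 hi.1
    rw [rho_append] at ih
    rw [commutesAt_append] at hc
    exact swap _ _ _ _ _ hc (ih (hs.rho hH hxy))
  | binary s i t t' hd hi hc ht ht' ih ih' =>
    obtain ⟨l, x, y, r, rfl, rfl, hxy, hr⟩ := isLegalAscent_iff.1 hi.1
    rw [rho_append] at ih'
    rw [lam_append] at ih
    rw [commutesAt_append] at hc
    exact bracket _ _ _ _ _ _ (ih (hs.lam hH hxy hr hc)) (ih' (hs.rho hH hxy))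

lemma IsDerivationTree.leaves_spec (hH : IsTransitiveHallSet θ H) {s : List (FreeMagma A)}
    {T : DTree A} (hT : IsDerivationTree θ H s T) (hs : IsStandard H s) :
    ∀ s' ∈ T.leaves, IsStandard H s' ∧ IsDecreasing H s' := by
  refine hT.leaves_induction hH (motive := fun _ L => ∀ s' ∈ L, IsStandard H s' ∧ IsDecreasing H s')
    (fun s hs hd => by simp [hs, hd]) (fun _ _ _ _ _ _ h => h) (fun _ _ _ _ _ _ h h' s' hs' => ?_) hs
  exact (List.mem_append.1 hs').elim (h s') (h' s')

end THS

namespace THS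

universe u v

variable {A : Type u} {θ : SimpleGraph A}

/-! ## Morphisms out of the trace monoid -/

/-- The morphism of monoids extending a map on letters that respects commutations. -/
def traceLift {M : Type v} [Monoid M] (f : A → M)
    (hf : ∀ a b, θ.Adj a b → f a * f b = f b * f a) : TraceMonoid θ →* M :=
  PresentedMonoid.lift f (by rintro _ _ ⟨a, b, h⟩; simpa using hf a b h)

@[simp]
lemma traceLift_letter {M : Type v} [Monoid M] (f : A → M)
    (hf : ∀ a b, θ.Adj a b → f a * f b = f b * f a) (a : A) :
    traceLift f hf (letter θ a) = f a := rfl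

lemma letter_comm {a b : A} (h : θ.Adj a b) :
    letter θ a * letter θ b = letter θ b * letter θ a :=
  PresentedMonoid.mk_eq_mk_of_rel (.swap a b h)

@[simp]
lemma traceOf_nil : traceOf θ [] = 1 := rfl

@[simp]
lemma traceOf_cons (a : A) (w : List A) : traceOf θ (a :: w) = letter θ a * traceOf θ w := by
  simp [traceOf]

@[simp]
lemma traceOf_append (w w' : List A) : traceOf θ (w ++ w') = traceOf θ w * traceOf θ w' := by
  simp [traceOf]

lemma traceOf_surjective : Function.Surjective (traceOf θ) := by
  intro m
  induction m using PresentedMonoid.inductionOn with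
  | h w =>
    refine ⟨w.toList, ?_⟩
    induction w using FreeMonoid.inductionOn' with
    | one => rfl
    | of_mul a w ih => rw [FreeMonoid.toList_of_mul, traceOf_cons, ih, map_mul]; rfl

/-- The multidegree of a trace: the multiset of its letters. -/
def multidegree (θ : SimpleGraph A) : TraceMonoid θ →* Multiplicative (Multiset A) :=
  traceLift (fun a => .ofAdd {a}) fun _ _ _ => mul_comm _ _

lemma multidegree_traceOf (w : List A) :
    multidegree θ (traceOf θ w) = .ofAdd (w : Multiset A) := by
  induction w with
  | nil => rfl
  | cons a w ih =>
    rw [traceOf_cons, map_mul, ih, multidegree, traceLift_letter, ← ofAdd_add]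
    rfl

/-- The representing words are permutations of a single word, so the alphabet may be infinite. -/
lemma finite_multidegree_fiber (d : Multiplicative (Multiset A)) :
    {m : TraceMonoid θ | multidegree θ m = d}.Finite := by
  obtain ⟨l, hl⟩ := Quotient.exists_rep d.toAdd
  refine ((List.finite_toSet l.permutations).image (traceOf θ)).subset fun m hm => ?_
  obtain ⟨w, rfl⟩ := traceOf_surjective m
  refine ⟨w, List.mem_permutations.2 (Multiset.coe_eq_coe.1 ?_), rfl⟩
  rw [Set.mem_ofPred_eq, multidegree_traceOf] at hm
  exact (congrArg Multiplicative.toAdd hm).trans hl.symm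

/-! ## Letters of trees -/

/-- The leaves of a tree, from left to right. -/
def leafWord : FreeMagma A → List A
  | .of a => [a]
  | .mul x y => leafWord x ++ leafWord y

@[simp]
lemma leafWord_of (a : A) : leafWord (.of a) = [a] := rfl

@[simp]
lemma leafWord_mul (x y : FreeMagma A) : leafWord (x * y) = leafWord x ++ leafWord y := rfl

lemma leafWord_ne_nil (x : FreeMagma A) : leafWord x ≠ [] := by
  induction x with
  | ih1 a => simp
  | ih2 x y ihx ihy => exact List.append_ne_nil_of_left_ne_nil ihx _

@[simp]
lemma foliage_of (a : A) : foliage θ (.of a) = letter θ a := rfl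

lemma foliage_eq_traceOf (x : FreeMagma A) : foliage θ x = traceOf θ (leafWord x) := by
  induction x with
  | ih1 a => simp
  | ih2 x y ihx ihy => rw [map_mul, ihx, ihy, ← traceOf_append]; rfl

/-- Lengths are additive and a tree has at least one leaf. Multiplicities in a decreasing sequence
can thus be read off from its factors. -/
lemma foliage_pow_injective (x : FreeMagma A) :
    Function.Injective fun n : ℕ => foliage θ x ^ n := by
  intro m n h
  have h' := congrArg (fun t => (multidegree θ t).toAdd.card) h
  simpa [foliage_eq_traceOf, multidegree_traceOf, leafWord_ne_nil] using h'

lemma mem_alph_traceOf {a : A} {w : List A} (h : a ∈ w) : a ∈ alph (traceOf θ w) := by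
  obtain ⟨l, r, rfl⟩ := List.append_of_mem h
  exact ⟨traceOf θ l, traceOf θ r, by simp [mul_assoc]⟩

open Classical in
/-- The projection to the words in two letters that do not commute. -/
noncomputable def proj (θ : SimpleGraph A) (a b : A) (hab : ¬ θ.Adj a b) :
    TraceMonoid θ →* FreeMonoid A :=
  traceLift (fun c => if c = a ∨ c = b then .of c else 1) fun c d hcd => by
    by_cases hc : c = a ∨ c = b <;> by_cases hd : d = a ∨ d = b <;> simp only [hc, hd] <;> try simp
    -- Both letters survive: either they coincide, or they are `a` and `b`, which do not commute.
    rcases hc with rfl | rfl <;> rcases hd with rfl | rfl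
    · rfl
    · exact absurd hcd hab
    · exact absurd hcd.symm hab
    · rfl

open Classical in
lemma proj_traceOf (a b : A) (hab : ¬ θ.Adj a b) (w : List A) :
    (proj θ a b hab (traceOf θ w)).toList = w.filter fun c => c = a ∨ c = b := by
  induction w with
  | nil => rfl
  | cons c w ih =>
    rw [traceOf_cons, map_mul, FreeMonoid.toList_mul, ih, proj, traceLift_letter]
    by_cases hc : c = a ∨ c = b
    · simp [hc]
    · simp [hc]

/-- If `a` and `b` did not commute, projecting to words in these two letters would give a nonempty
power of `a` commuting with a nonempty power of `b` in a free monoid; comparing first letters is a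
contradiction. -/
lemma DisjComm.adj {w w' : List A} (h : DisjComm (traceOf θ w) (traceOf θ w')) {a b : A}
    (ha : a ∈ w) (hb : b ∈ w') : θ.Adj a b := by
  classical
  by_contra hab
  have hw : b ∉ w := fun h' => h.2.le_bot ⟨mem_alph_traceOf h', mem_alph_traceOf hb⟩
  have hw' : a ∉ w' := fun h' => h.2.le_bot ⟨mem_alph_traceOf ha, mem_alph_traceOf h'⟩
  have key := congrArg (fun t => (proj θ a b hab t).toList) h.1
  simp only [map_mul, FreeMonoid.toList_mul, proj_traceOf] at key
  have h1 : a ∈ w.filter fun c => c = a ∨ c = b := by simp [ha]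
  have h2 : b ∈ w'.filter fun c => c = a ∨ c = b := by simp [hb]
  obtain ⟨c, l, hl⟩ := List.exists_cons_of_ne_nil (List.ne_nil_of_mem h1)
  obtain ⟨d, l', hl'⟩ := List.exists_cons_of_ne_nil (List.ne_nil_of_mem h2)
  have hc : c ∈ w.filter fun c => c = a ∨ c = b := hl ▸ List.mem_cons_self
  have hd : d ∈ w'.filter fun c => c = a ∨ c = b := hl' ▸ List.mem_cons_self
  rw [hl, hl'] at key
  have hcd : c = d := (List.cons.inj key).1
  simp only [List.mem_filter, decide_eq_true_eq] at hc hd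
  subst hcd
  rcases hc.2 with rfl | rfl
  · exact hw' hd.1
  · exact hw hc.1

/-! ## Lie polynomials of trees -/

variable (K : Type v) [CommRing K]

@[simp]
lemma lieEval_of (a : A) :
    lieEval K θ (.of a) = MonoidAlgebra.of K (TraceMonoid θ) (letter θ a) := rfl

@[simp]
lemma lieEval_mul (x y : FreeMagma A) :
    lieEval K θ (x * y) = lieEval K θ x * lieEval K θ y - lieEval K θ y * lieEval K θ x := rfl

/-- The centralizer of `P` is closed under products and differences. -/
lemma commute_lieEval {P : Poly K θ} {x : FreeMagma A}
    (h : ∀ a ∈ leafWord x, Commute P (lieEval K θ (.of a))) : Commute P (lieEval K θ x) := by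
  induction x with
  | ih1 a => exact h a (by simp)
  | ih2 x y ihx ihy =>
    have hx := ihx fun a ha => h a (List.mem_append_left _ ha)
    have hy := ihy fun a ha => h a (List.mem_append_right _ ha)
    exact (hx.mul_right hy).sub_right (hy.mul_right hx)

lemma DisjComm.commute_lieEval {x y : FreeMagma A}
    (h : DisjComm (foliage θ x) (foliage θ y)) : Commute (lieEval K θ x) (lieEval K θ y) := by
  rw [foliage_eq_traceOf, foliage_eq_traceOf] at h
  refine THS.commute_lieEval K fun b hb => (THS.commute_lieEval K fun a ha => ?_).symm
  have := letter_comm (h.adj ha hb)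
  simp only [lieEval_of]
  exact (Commute.map (f := MonoidAlgebra.of K (TraceMonoid θ)) this).symm

@[simp]
lemma seqEval_append (s t : List (FreeMagma A)) :
    seqEval K θ (s ++ t) = seqEval K θ s * seqEval K θ t := by simp [seqEval]

@[simp]
lemma seqEval_cons (x : FreeMagma A) (t : List (FreeMagma A)) :
    seqEval K θ (x :: t) = lieEval K θ x * seqEval K θ t := by simp [seqEval]

lemma seqEval_swap {x y : FreeMagma A} (h : DisjComm (foliage θ x) (foliage θ y))
    (l r : List (FreeMagma A)) :
    seqEval K θ (l ++ x :: y :: r) = seqEval K θ (l ++ y :: x :: r) := by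
  simp only [seqEval_append, seqEval_cons, ← mul_assoc (lieEval K θ _) (lieEval K θ _),
    (h.commute_lieEval K).eq]

lemma seqEval_bracket (l r : List (FreeMagma A)) (x y : FreeMagma A) :
    seqEval K θ (l ++ x :: y :: r) =
      seqEval K θ (l ++ (x * y) :: r) + seqEval K θ (l ++ y :: x :: r) := by
  simp only [seqEval_append, seqEval_cons, lieEval_mul]
  noncomm_ring

lemma seqEval_letterSeq (w : List A) :
    seqEval K θ (letterSeq w) = MonoidAlgebra.single (traceOf θ w) 1 := by
  rw [← MonoidAlgebra.of_apply]
  induction w with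
  | nil => exact (map_one _).symm
  | cons a w ih =>
    rw [traceOf_cons, map_mul, ← ih, ← lieEval_of]
    exact seqEval_cons K _ _

/-! ## Homogeneity -/

/-- The polynomials all of whose monomials have multidegree `d`. -/
noncomputable def homogeneous (θ : SimpleGraph A) (d : Multiplicative (Multiset A)) :
    Submodule K (Poly K θ) :=
  (Finsupp.supported K K {m | multidegree θ m = d}).comap
    (MonoidAlgebra.coeffLinearEquiv K).toLinearMap

variable {K}

lemma mem_homogeneous {d : Multiplicative (Multiset A)} {P : Poly K θ} :
    P ∈ homogeneous K θ d ↔ ∀ m ∈ P.coeff.support, multidegree θ m = d := Iff.rfl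

lemma mul_mem_homogeneous {d e : Multiplicative (Multiset A)} {P Q : Poly K θ}
    (hP : P ∈ homogeneous K θ d) (hQ : Q ∈ homogeneous K θ e) :
    P * Q ∈ homogeneous K θ (d * e) := by
  classical
  rw [mem_homogeneous] at *
  intro m hm
  obtain ⟨p, hp, q, hq, rfl⟩ := Finset.mem_mul.1 (MonoidAlgebra.support_coeff_mul_subset _ _ hm)
  rw [map_mul, hP p hp, hQ q hq]

lemma single_mem_homogeneous (m : TraceMonoid θ) (c : K) :
    MonoidAlgebra.single m c ∈ homogeneous K θ (multidegree θ m) :=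
  Finsupp.single_mem_supported K c rfl

lemma lieEval_mem_homogeneous (x : FreeMagma A) :
    lieEval K θ x ∈ homogeneous K θ (multidegree θ (foliage θ x)) := by
  induction x with
  | ih1 a => exact single_mem_homogeneous _ _
  | ih2 x y ihx ihy =>
    rw [map_mul, map_mul]
    refine Submodule.sub_mem _ (mul_mem_homogeneous ihx ihy) ?_
    rw [mul_comm]
    exact mul_mem_homogeneous ihy ihx

lemma seqEval_mem_homogeneous (s : List (FreeMagma A)) :
    seqEval K θ s ∈ homogeneous K θ (multidegree θ (s.map (foliage θ)).prod) := by
  induction s with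
  | nil => exact single_mem_homogeneous _ _
  | cons x s ih =>
    rw [List.map_cons, List.prod_cons, map_mul, seqEval_cons]
    exact mul_mem_homogeneous (lieEval_mem_homogeneous x) ih

/-- A family of homogeneous vectors indexed by the monomials that spans every homogeneous component
is linearly independent, if these components have finite rank. -/
lemma linearIndependent_of_homogeneous {M D : Type*} (deg : M → D)
    (hdeg : ∀ d, {m | deg m = d}.Finite) (v : M → M →₀ K)
    (hv : ∀ m, v m ∈ Finsupp.supported K K {n | deg n = deg m})
    (hspan : ∀ m, Finsupp.single m 1 ∈ Submodule.span K (v '' {n | deg n = deg m})) :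
    LinearIndependent K v := by
  rw [linearIndependent_iff]
  intro x hx
  -- A finite union of whole components containing the support of the relation `x`; the problem
  -- becomes one about a finite free module.
  set S : Set M := ⋃ m ∈ x.support, {n | deg n = deg m} with hS
  have hfin : S.Finite := x.support.finite_toSet.biUnion fun m _ => hdeg _
  have hsat : ∀ {m n}, m ∈ S → deg n = deg m → n ∈ S := by
    intro m n hm hn
    simp only [hS, Set.mem_iUnion] at hm ⊢
    obtain ⟨p, hp, h⟩ := hm
    exact ⟨p, hp, hn.trans h⟩
  have hmap : ∀ z ∈ Finsupp.supported K K S,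
      Finsupp.linearCombination K v z ∈ Finsupp.supported K K S := by
    intro z hz
    rw [Finsupp.linearCombination_apply]
    refine Submodule.sum_mem _ fun m hm => Submodule.smul_mem _ _ ?_
    exact Finsupp.supported_mono (fun n hn => hsat (hz hm) hn) (hv m)
  -- Since the family is indexed by the monomials themselves, linear combination is an endomorphism.
  let Φ : Finsupp.supported K K S →ₗ[K] Finsupp.supported K K S :=
    (Finsupp.linearCombination K v).restrict hmap
  have hsurj : Function.Surjective Φ := by
    rintro ⟨z, hz⟩
    have hle : Finsupp.supported K K S ≤
        (Finsupp.supported K K S).map (Finsupp.linearCombination K v) := by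
      rw [← Finsupp.span_image_eq_map_linearCombination, Finsupp.supported_eq_span_single,
        Submodule.span_le]
      rintro _ ⟨m, hm, rfl⟩
      exact Submodule.span_mono (Set.image_mono fun n hn => hsat hm hn) (hspan m)
    obtain ⟨y, hy, rfl⟩ := hle hz
    exact ⟨⟨y, hy⟩, rfl⟩
  have := hfin.to_subtype
  have : Module.Finite K (Finsupp.supported K K S) :=
    Module.Finite.equiv (Finsupp.supportedEquivFinsupp S).symm
  have hinj := OrzechProperty.injective_of_surjective_endomorphism Φ hsurj
  have hxS : x ∈ Finsupp.supported K K S := fun m hm =>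
    Set.mem_iUnion₂.2 ⟨m, hm, rfl⟩
  have h0 : (⟨x, hxS⟩ : Finsupp.supported K K S) = 0 :=
    hinj (Subtype.ext (by rw [map_zero]; exact hx))
  exact congrArg Subtype.val h0

end THS

namespace THS

universe u v

variable {A : Type u} {θ : SimpleGraph A} {H : Set (FreeMagma A)} [LinearOrder H]

/-! ## Decreasing sequences and factorizations -/

/-- The element of the restricted product that records the multiplicities in a sequence. -/
noncomputable def toRestrictedProd (θ : SimpleGraph A) (s : List H) :
    RestrictedProd (ι := Hᵒᵈ)
      (fun h : Hᵒᵈ => Submonoid.closure {foliage θ (OrderDual.ofDual h).1}) :=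
  ⟨fun h => ⟨foliage θ (OrderDual.ofDual h).1 ^ s.count (OrderDual.ofDual h),
      Submonoid.pow_mem _ (Submonoid.subset_closure (Set.mem_singleton _)) _⟩, by
    refine (List.finite_toSet (s.map OrderDual.toDual)).subset fun h hh => ?_
    by_contra hs
    have h0 : s.count (OrderDual.ofDual h) = 0 :=
      List.count_eq_zero.2 fun h' => hs (List.mem_map.2 ⟨_, h', rfl⟩)
    exact hh (Subtype.ext (by simp [h0]))⟩

/-- A decreasing sequence is the concatenation of its constant blocks; increasing order in `Hᵒᵈ` is
decreasing order in `H`. -/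
lemma orderedProd_toRestrictedProd {s : List H} (hs : s.Pairwise (· ≥ ·)) :
    orderedProd (toRestrictedProd θ s) = (s.map fun h => foliage θ h.1).prod := by
  set F := (toRestrictedProd θ s).2.toFinset with hF
  set L := F.sort (· ≤ ·) with hL
  -- The support is defined by nontrivial factors, so a term of `s` could be missed only if a
  -- positive power of its foliage were `1`.
  have hmem : ∀ h : H, OrderDual.toDual h ∉ F → s.count h = 0 := by
    intro h hh
    have h1 : foliage θ h.1 ^ s.count h = 1 := by
      by_contra h1
      exact hh ((Set.Finite.mem_toFinset _).2 fun e => h1 (congrArg Subtype.val e))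
    exact foliage_pow_injective h.1 (h1.trans (pow_zero _).symm)
  have hs' : s = L.flatMap fun h =>
      List.replicate (s.count (OrderDual.ofDual h)) (OrderDual.ofDual h) := by
    refine List.Perm.eq_of_pairwise (le := (· ≥ ·)) (fun a b _ _ h h' => le_antisymm h' h) hs ?_ ?_
    · refine List.pairwise_flatMap.2 ⟨fun h _ => ?_, ?_⟩
      · exact List.pairwise_replicate.2 (Or.inr le_rfl)
      · refine (F.pairwise_sort (· ≤ ·)).imp fun {a b} hab x hx y hy => ?_
        rw [List.eq_of_mem_replicate hx, List.eq_of_mem_replicate hy]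
        exact hab
    · rw [List.perm_iff_count]
      intro a
      rw [List.count_flatMap, ← List.sum_toFinset _ (F.sort_nodup (· ≤ ·)), F.sort_toFinset]
      rw [Finset.sum_eq_single (OrderDual.toDual a)]
      · simp
      · intro b _ hb
        simp only [Function.comp, List.count_replicate]
        exact if_neg fun e => hb (congrArg OrderDual.toDual (eq_of_beq e))
      · intro ha
        simp [hmem a ha]
  conv_rhs => rw [hs']
  rw [List.map_flatMap, List.flatMap_def, List.prod_flatten, List.map_map]
  unfold orderedProd
  congr 1
  refine List.map_congr_left fun h _ => ?_
  simp [toRestrictedProd]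

/-- Injectivity of the factorization identifies the powers, injectivity of powers identifies the
multiplicities, and a decreasing sequence is determined by its multiplicities. -/
lemma IsDecreasing.eq_of_prod_eq (hH : IsTransitiveHallSet θ H) {s t : List (FreeMagma A)}
    (hs : IsDecreasing H s) (ht : IsDecreasing H t)
    (h : (s.map (foliage θ)).prod = (t.map (foliage θ)).prod) : s = t := by
  have key : ∀ s : List (FreeMagma A), IsDecreasing H s →
      ∃ s' : List H, s = s'.map Subtype.val ∧ s'.Pairwise (· ≥ ·) := by
    rintro s ⟨h1, h2⟩
    lift s to List H using h1
    exact ⟨s, rfl, (List.pairwise_map.1 h2).imp fun ⟨_, _, h⟩ => h⟩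
  obtain ⟨s, rfl, hs'⟩ := key s hs
  obtain ⟨t, rfl, ht'⟩ := key t ht
  simp only [List.map_map] at h
  have heq : toRestrictedProd θ s = toRestrictedProd θ t := by
    apply hH.factorization.1
    rw [orderedProd_toRestrictedProd hs', orderedProd_toRestrictedProd ht']
    exact h
  congr 1
  refine List.Perm.eq_of_pairwise (le := (· ≥ ·)) (fun a b _ _ h h' => le_antisymm h' h) hs' ht' ?_
  rw [List.perm_iff_count]
  intro a
  exact foliage_pow_injective a.1
    (congrArg (fun g => ((g.1 (OrderDual.toDual a) : _) : TraceMonoid θ)) heq)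

/-! ## Foliages along rewriting -/

lemma prod_foliage_bracket (l r : List (FreeMagma A)) (x y : FreeMagma A) :
    ((l ++ (x * y) :: r).map (foliage θ)).prod = ((l ++ x :: y :: r).map (foliage θ)).prod := by
  simp [mul_assoc]

lemma prod_foliage_swap {x y : FreeMagma A} (h : DisjComm (foliage θ x) (foliage θ y))
    (l r : List (FreeMagma A)) :
    ((l ++ y :: x :: r).map (foliage θ)).prod = ((l ++ x :: y :: r).map (foliage θ)).prod := by
  simp [← mul_assoc (foliage θ _) (foliage θ _), h.1]

/-- A right branch may change the trace, but never its multidegree. -/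
lemma multidegree_prod_foliage_swap (l r : List (FreeMagma A)) (x y : FreeMagma A) :
    multidegree θ ((l ++ y :: x :: r).map (foliage θ)).prod =
      multidegree θ ((l ++ x :: y :: r).map (foliage θ)).prod := by
  simp [mul_left_comm]

lemma Step.prod_foliage {s s' : List (FreeMagma A)} (h : Step θ H s s') :
    (s'.map (foliage θ)).prod = (s.map (foliage θ)).prod := by
  obtain ⟨l, x, y, r, rfl, -, -, ⟨-, rfl⟩ | ⟨hc, rfl⟩⟩ := step_iff.1 h
  · exact prod_foliage_bracket ..
  · exact prod_foliage_swap hc ..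

lemma Steps.prod_foliage {s s' : List (FreeMagma A)} (h : Steps θ H s s') :
    (s'.map (foliage θ)).prod = (s.map (foliage θ)).prod := by
  induction h with
  | refl => rfl
  | tail _ h ih => rw [h.prod_foliage, ih]

lemma prod_foliage_letterSeq (w : List A) :
    ((letterSeq w).map (foliage θ)).prod = traceOf θ w := by
  simp only [letterSeq, List.map_map]
  rfl

lemma IsDerivationTree.multidegree_leaves (hH : IsTransitiveHallSet θ H)
    {s : List (FreeMagma A)} {T : DTree A} (hT : IsDerivationTree θ H s T) (hs : IsStandard H s) :
    ∀ s' ∈ T.leaves, multidegree θ (s'.map (foliage θ)).prod =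
      multidegree θ (s.map (foliage θ)).prod := by
  refine hT.leaves_induction hH (motive := fun s L => ∀ s' ∈ L,
    multidegree θ (s'.map (foliage θ)).prod = multidegree θ (s.map (foliage θ)).prod)
    (fun s _ _ => by simp) (fun l x y r L hc ih s' hs' => ?_)
    (fun l x y r L L' ih ih' s' hs' => ?_) hs
  · rw [ih s' hs', multidegree_prod_foliage_swap]
  · rcases List.mem_append.1 hs' with h | h
    · rw [ih s' h, prod_foliage_bracket]
    · rw [ih' s' h, multidegree_prod_foliage_swap]

lemma IsDerivationTree.seqEval_eq (K : Type v) [CommRing K] (hH : IsTransitiveHallSet θ H)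
    {s : List (FreeMagma A)} {T : DTree A} (hT : IsDerivationTree θ H s T) (hs : IsStandard H s) :
    seqEval K θ s = (T.leaves.map (seqEval K θ)).sum := by
  refine hT.leaves_induction hH (motive := fun s L => seqEval K θ s = (L.map (seqEval K θ)).sum)
    (fun s _ _ => by simp) (fun l x y r L hc ih => ?_) (fun l x y r L L' ih ih' => ?_) hs
  · rw [seqEval_swap K hc, ih]
  · rw [seqEval_bracket, ih, ih', List.map_append, List.sum_append]

/-! ## The basis -/

variable (H) in
/-- The decreasing standard sequences. -/
abbrev DecSeq : Type u := {s : List (FreeMagma A) // IsStandard H s ∧ IsDecreasing H s}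

variable (θ) in
/-- The trace of a decreasing standard sequence. -/
def DecSeq.trace (s : DecSeq H) : TraceMonoid θ := (s.1.map (foliage θ)).prod

/-- Surjectivity comes from rewriting a word to its normal form, injectivity from the factorization.
-/
lemma DecSeq.trace_bijective (hH : IsTransitiveHallSet θ H) :
    Function.Bijective (DecSeq.trace θ (H := H)) := by
  refine ⟨fun s t h => Subtype.ext (s.2.2.eq_of_prod_eq hH t.2.2 h), fun m => ?_⟩
  obtain ⟨w, rfl⟩ := traceOf_surjective m
  obtain ⟨s, hs, hd, h⟩ := exists_steps_isDecreasing hH _ (isStandard_letterSeq hH w)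
  exact ⟨⟨s, hs, hd⟩, h.prod_foliage.trans (prod_foliage_letterSeq w)⟩

section Basis

variable (K : Type v) [CommRing K] (hH : IsTransitiveHallSet θ H)
include hH

/-- Expand a representing word along its derivation tree; every leaf keeps the multidegree of the
word. -/
lemma single_mem_span_decSeq (m : TraceMonoid θ) :
    MonoidAlgebra.single m 1 ∈ Submodule.span K ((fun s : DecSeq H => seqEval K θ s.1) ''
      {s | multidegree θ (s.trace θ) = multidegree θ m}) := by
  obtain ⟨w, rfl⟩ := traceOf_surjective m
  have hw := isStandard_letterSeq hH w
  obtain ⟨T, hT⟩ := exists_isDerivationTree hH _ hw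
  rw [← seqEval_letterSeq, hT.seqEval_eq K hH hw]
  refine list_sum_mem fun P hP => ?_
  obtain ⟨s, hs, rfl⟩ := List.mem_map.1 hP
  refine Submodule.subset_span ⟨⟨s, hT.leaves_spec hH hw s hs⟩, ?_, rfl⟩
  exact (hT.multidegree_leaves hH hw s hs).trans (by rw [prod_foliage_letterSeq])

lemma linearIndependent_decSeq :
    LinearIndependent K fun s : DecSeq H => seqEval K θ s.1 := by
  -- Reindexing by traces puts as many vectors as monomials in each component.
  let e : DecSeq H ≃ TraceMonoid θ := Equiv.ofBijective _ (DecSeq.trace_bijective hH)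
  let φ := MonoidAlgebra.coeffLinearEquiv K (S := K) (M := TraceMonoid θ)
  have key : LinearIndependent K fun m => φ (seqEval K θ (e.symm m).1) := by
    refine linearIndependent_of_homogeneous (multidegree θ) finite_multidegree_fiber _
      (fun m => ?_) fun m => ?_
    · have := seqEval_mem_homogeneous (K := K) (θ := θ) (e.symm m).1
      have hm : ((e.symm m).1.map (foliage θ)).prod = m := e.apply_symm_apply m
      rw [hm] at this
      exact this
    · have := Submodule.mem_map_of_mem (f := φ.toLinearMap) (single_mem_span_decSeq K hH m)
      rw [Submodule.map_span, Set.image_image] at this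
      refine Submodule.span_mono ?_ this
      rintro _ ⟨s, hs, rfl⟩
      refine ⟨e s, hs, ?_⟩
      simp only [e.symm_apply_apply]
      rfl
  have h2 : LinearIndependent K fun s : DecSeq H => φ (seqEval K θ s.1) := by
    rw [← linearIndependent_equiv e.symm]
    exact key
  exact h2.of_comp φ.toLinearMap

/-- The PBW basis associated with a transitive Hall set. -/
noncomputable def pbwBasis : Module.Basis (DecSeq H) K (Poly K θ) :=
  Module.Basis.mk (linearIndependent_decSeq K hH) <| by
    intro P _
    rw [← MonoidAlgebra.sum_coeff_single P]
    refine Submodule.sum_mem _ fun m _ => ?_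
    rw [← mul_one (P.coeff m), ← smul_eq_mul, ← MonoidAlgebra.smul_single]
    exact Submodule.smul_mem _ _
      (Submodule.span_mono (Set.image_subset_range _ _) (single_mem_span_decSeq K hH m))

lemma pbwBasis_apply (s : DecSeq H) : pbwBasis K hH s = seqEval K θ s.1 := by
  simp [pbwBasis]

lemma pbwBasis_repr_sum (L : List (List (FreeMagma A)))
    (hL : ∀ s ∈ L, IsStandard H s ∧ IsDecreasing H s) (s : DecSeq H) :
    open Classical in (pbwBasis K hH).repr (L.map (seqEval K θ)).sum s = (L.count s.1 : K) := by
  classical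
  induction L with
  | nil => simp
  | cons t L ih =>
    have ht := pbwBasis_apply K hH ⟨t, hL t (by simp)⟩
    rw [List.map_cons, List.sum_cons, map_add, Finsupp.add_apply,
      ih fun s hs => hL s (by simp [hs]), ← ht, Module.Basis.repr_self, List.count_cons,
      Finsupp.single_apply, add_comm]
    by_cases h : t = s.1 <;> simp [h, Subtype.ext_iff]

/-- By linearity it suffices to treat one trace, which is `[w m]` and hence the sum over the leaves
of `T m`. -/
lemma pbwBasis_repr (P : Poly K θ) (w : TraceMonoid θ → List A) (T : TraceMonoid θ → DTree A)
    (hw : ∀ m, traceOf θ (w m) = m) (hT : ∀ m, IsDerivationTree θ H (letterSeq (w m)) (T m))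
    (s : DecSeq H) :
    (pbwBasis K hH).repr P s = ∑ m ∈ P.coeff.support, P.coeff m * ((T m).mult s.1 : K) := by
  have hm : ∀ m, (pbwBasis K hH).repr (MonoidAlgebra.single m 1) s = ((T m).mult s.1 : K) := by
    intro m
    have hs := isStandard_letterSeq hH (w m)
    have h1 := seqEval_letterSeq (θ := θ) K (w m)
    rw [hw m, (hT m).seqEval_eq K hH hs] at h1
    rw [← h1, pbwBasis_repr_sum K hH _ ((hT m).leaves_spec hH hs)]
    rfl
  conv_lhs => rw [← MonoidAlgebra.sum_coeff_single P]
  rw [Finsupp.sum, map_sum, Finsupp.finsetSum_apply]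
  refine Finset.sum_congr rfl fun m _ => ?_
  rw [← hm m, ← smul_eq_mul, ← Finsupp.smul_apply, ← map_smul, MonoidAlgebra.smul_single,
    smul_eq_mul, mul_one]

end Basis

end THS


theorem mainTheorem8 {A : Type*} (θ : SimpleGraph A) (H : Set (FreeMagma A)) [LinearOrder H]
    (hH : THS.IsTransitiveHallSet θ H) (K : Type*) [CommRing K] :
    -- rewriting of standard sequences: well defined, terminating, stuck exactly when decreasing
    (∀ s s', THS.IsStandard H s → THS.Step θ H s s' → THS.IsStandard H s') ∧
    (WellFounded fun s' s => THS.IsStandard H s ∧ THS.Step θ H s s') ∧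
    (∀ s, THS.IsStandard H s → ((¬ ∃ s', THS.Step θ H s s') ↔ THS.IsDecreasing H s)) ∧
    -- every standard sequence leads to a unique decreasing standard sequence
    (∀ s, THS.IsStandard H s →
      ∃! s', THS.IsStandard H s' ∧ THS.IsDecreasing H s' ∧ THS.Steps θ H s s') ∧
    -- the derivation tree exists, is unique, and yields the expansion of `[s]`
    (∀ s, THS.IsStandard H s → ∃ T, THS.IsDerivationTree θ H s T ∧
      (∀ T', THS.IsDerivationTree θ H s T' → T' = T) ∧
      (∀ s' ∈ T.leaves, THS.IsStandard H s' ∧ THS.IsDecreasing H s') ∧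
      THS.seqEval K θ s = (T.leaves.map (THS.seqEval K θ)).sum) ∧
    -- factorization of the trace of a word into a decreasing product of Hall traces
    (∀ w : List A, THS.IsStandard H (THS.letterSeq w) ∧
      ∃ s', THS.IsStandard H s' ∧ THS.IsDecreasing H s' ∧
        THS.Steps θ H (THS.letterSeq w) s' ∧
        (s'.map (THS.foliage θ)).prod = THS.traceOf θ w ∧
        ∀ t, THS.IsDecreasing H t → (t.map (THS.foliage θ)).prod = THS.traceOf θ w → t = s') ∧
    -- the products `[s]`, `s` decreasing, are a basis, in which polynomials are expanded by
    -- counting the leaves of the derivation trees of words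
    (∃ b : Module.Basis {s : List (FreeMagma A) // THS.IsStandard H s ∧ THS.IsDecreasing H s} K
        (THS.Poly K θ),
      (∀ s, b s = THS.seqEval K θ s.1) ∧
      ∀ (P : THS.Poly K θ) (w : THS.TraceMonoid θ → List A)
        (T : THS.TraceMonoid θ → THS.DTree A),
        (∀ m, THS.traceOf θ (w m) = m) →
        (∀ m, THS.IsDerivationTree θ H (THS.letterSeq (w m)) (T m)) →
        ∀ s, b.repr P s = ∑ m ∈ P.coeff.support, P.coeff m * ((T m).mult s.1 : K)) := by

  refine ⟨fun s s' hs h => hs.step hH h, ?_, fun s hs => THS.not_exists_step_iff hs.1,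
    fun s hs => ?_, fun s hs => ?_, fun w => ⟨THS.isStandard_letterSeq hH w, ?_⟩,
    THS.pbwBasis K hH, THS.pbwBasis_apply K hH, THS.pbwBasis_repr K hH⟩
  · exact Subrelation.wf (fun h => h.2.move) (THS.wellFounded_move (H := H))
  · obtain ⟨s', h, h', h''⟩ := THS.exists_steps_isDecreasing hH s hs
    -- Two decreasing sequences reached from `s` both have the foliage product of `s`, hence
    -- coincide.
    exact ⟨s', ⟨h, h', h''⟩, fun t ⟨_, ht, ht'⟩ =>
      ht.eq_of_prod_eq hH h' (ht'.prod_foliage.trans h''.prod_foliage.symm)⟩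
  · obtain ⟨T, hT⟩ := THS.exists_isDerivationTree hH s hs
    exact ⟨T, hT, fun _ => hT.eq, hT.leaves_spec hH hs, hT.seqEval_eq K hH hs⟩
  · obtain ⟨s', h, h', h''⟩ :=
      THS.exists_steps_isDecreasing hH _ (THS.isStandard_letterSeq hH w)
    have hp := h''.prod_foliage.trans (THS.prod_foliage_letterSeq w)
    exact ⟨s', h, h', h'', hp, fun t ht e => ht.eq_of_prod_eq hH h' (e.trans hp.symm)⟩
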